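/- **Setting.** For $K\ge 1$ let $\Delta_K=\{p\in\mathbb R_{\ge 0}^K:\sum_x p_x=1\}$ and $[K]=\{1,\dots,K\}$. A scoring rule is a function $\ell:\Delta_K\times[K]\to\mathbb R$. Write $\ell(p;q)=\sum_{x\in[K]}q_x\,\ell(p,x)$ for $p,q\in\Delta_K$, and let $\ell(p)=\ell(p;p)$ be its univariate form. The rule is proper if $\ell(p;p)\le \ell(p';p)$ for all $p,p'\in\Delta_K$. Let $\mathcal L$ be the set of all proper scoring rules with values in $[-1,1]$; their univariate forms are concave on $\Delta_K$. A vector $v\in\mathbb R^K$ is called a subgradient of $\ell$ at $p\in\Delta_K$ if $\ell(q)\le \ell(p)+\langle q-p,v\rangle$ for all $q\in\Delta_K$. A function on a set $\Theta\subseteq\mathbb R^N$ is called piecewise locally Lipschitz if $\Theta$ is a union of countably many (for example, finitely many) subsets such that the restriction of the function to each of them is locally Lipschitz. **Theorem.** Let $K\ge 4$, $N\ge 0$, and $\Theta\subseteq\mathbb R^N$. Let $(\ell_\theta)_{\theta\in\Theta}$ be a family of elements of $\mathcal L$ and, for every $\theta\in\Theta$ and $p\in\Delta_K$, let $\nabla\ell_\theta(p)\in\mathbb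 R^K$ be a subgradient of $\ell_\theta$ at $p$, such that for every $p\in\Delta_K$ both maps $\theta\mapsto \ell_\theta(p)$ and $\theta\mapsto\nabla\ell_\theta(p)$ are piecewise locally Lipschitz on $\Theta$. Then there exists $\ell\in\mathcal L$ such that for no finite (positive) Borel measure $\mu$ on $\Theta$ is it the case that, for all $p\in\Delta_K$, the function $\theta\mapsto\ell_\theta(p)$ is $\mu$-integrable and $$\ell(p)=\int_{\Theta}\ell_\theta(p)\,d\mu(\theta).$$ -/

import Mathlib

open MeasureTheory

namespace UCal

/-- A scoring rule (loss function) for `K` outcomes, in bivariate form: the penalty `ℓ p x` charged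
for the prediction `p ∈ Δ_K` when the outcome is `x`. -/
abbrev ScoringRule (K : ℕ) : Type := stdSimplex ℝ (Fin K) → Fin K → ℝ

/-- The expected penalty `ℓ(p; q) = E_{x ∼ q}[ℓ(p, x)]`. -/
def expectedPenalty {K : ℕ} (ℓ : ScoringRule K) (p q : stdSimplex ℝ (Fin K)) : ℝ :=
  ∑ x, (q : Fin K → ℝ) x * ℓ p x

/-- The univariate form `ℓ(p) = ℓ(p; p)`. -/
def univariate {K : ℕ} (ℓ : ScoringRule K) (p : stdSimplex ℝ (Fin K)) : ℝ :=
  expectedPenalty ℓ p p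

/-- Properness: predicting the true distribution minimizes the expected penalty. -/
def IsProper {K : ℕ} (ℓ : ScoringRule K) : Prop :=
  ∀ p p' : stdSimplex ℝ (Fin K), expectedPenalty ℓ p p ≤ expectedPenalty ℓ p' p

/-- The set of bounded proper scoring rules, with values in `[-1, 1]`. -/
def boundedProper (K : ℕ) : Set (ScoringRule K) :=
  {ℓ | IsProper ℓ ∧ ∀ p x, ℓ p x ∈ Set.Icc (-1 : ℝ) 1}

/-- `v` is a subgradient at `p` of the concave function `f` on the simplex:
`f q ≤ f p + ⟨q - p, v⟩` for every `q` in the simplex. -/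
def IsSubgradientAt {K : ℕ} (f : stdSimplex ℝ (Fin K) → ℝ) (p : stdSimplex ℝ (Fin K))
    (v : Fin K → ℝ) : Prop :=
  ∀ q : stdSimplex ℝ (Fin K),
    f q ≤ f p + ∑ x, ((q : Fin K → ℝ) x - (p : Fin K → ℝ) x) * v x

/-- `f` is piecewise locally Lipschitz: its domain is covered by countably many pieces (in
particular, finitely many) such that the restriction of `f` to each piece is locally Lipschitz. -/
def PiecewiseLocallyLipschitz {X Y : Type*} [PseudoEMetricSpace X] [PseudoEMetricSpace Y]
    (f : X → Y) : Prop :=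
  ∃ S : ℕ → Set X, (⋃ i, S i) = Set.univ ∧ ∀ i, LocallyLipschitzOn (S i) f

/-- `ℓ₀ = ∫ ℓ_θ dμ(θ)` as functions on the simplex (univariate forms), the integral being a
genuine one at every point of the simplex. -/
def IsMixture {K : ℕ} {T : Type*} [MeasurableSpace T] (ℓ₀ : ScoringRule K)
    (ℓ : T → ScoringRule K) (μ : Measure T) : Prop :=
  ∀ p : stdSimplex ℝ (Fin K),
    Integrable (fun θ => univariate (ℓ θ) p) μ ∧
      univariate ℓ₀ p = ∫ θ, univariate (ℓ θ) p ∂μ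

end UCal

/-!
The idea is to find a family of bounded proper scoring rules with more than `N` parameters, each of
which spans, up to affine functions, an extreme ray of the cone of concave functions. A mixture
equal to such a rule must contain a multiple of it, and the `N`-dimensional set `Θ` has no room for
all of them.

Everything happens on a planar triangle inside the simplex. For a convex `g`, the concave function
`min 0 (y - g x)` is rigid. Suppose it is an average of concave functions `φ`. Wherever it is affine
it has equality in Jensen's inequality, hence so has almost every `φ`
(`ae_jensenEq_of_integral`). Thus `φ` is affine on the regions below and above the graph of `g`, the
vertical slopes on each side do not depend on `x`, and the two branches meet on the graph; so `φ` is
`min 0 (y - g x)` times the difference of the two slopes, plus an affine function. The slope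
differences average to one, so some `φ` has a positive one
(`exists_cellwiseAffine_of_integral`).

Here `g = profile w` is piecewise linear with `N + 1` fixed breakpoints and slope jumps `w k > 0`,
so finitely many Jensen equalities suffice (`CellwiseAffine`). The parameters `w` are then an
explicit quotient of linear forms in the values of `φ` at finitely many points that do not depend on
`w` (`CellwiseAffine.second_difference`, `recover`). If every kinked rule were a mixture, the
composite of the sampling map `Θ → ℝ ^ m`, which is piecewise locally Lipschitz, with this smooth
quotient would map a subset of `Θ` onto a set containing an open box of `ℝ ^ (N + 1)`. This
contradicts the fact that such maps do not raise the Hausdorff dimension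
(`dimH_image_le_of_piecewiseLocallyLipschitz`, `dimH_image_recover_le`).
-/

namespace UCal

open Set

/-! ### Concave functions and equality in Jensen's inequality -/

/-- `φ` is affine along the segment `[z, w]` as far as the point `a • z + (1 - a) • w` can tell:
equality holds there in Jensen's inequality. -/
def JensenEq (φ : ℝ × ℝ → ℝ) (a : ℝ) (z w : ℝ × ℝ) : Prop :=
  φ (a • z + (1 - a) • w) = a * φ z + (1 - a) * φ w

/-- If an average of concave functions satisfies Jensen's inequality with equality somewhere, then
so does almost every one of them. -/
lemma ae_jensenEq_of_integral {T : Type*} [MeasurableSpace T] {μ : Measure T} {s : Set (ℝ × ℝ)}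
    {f : T → ℝ × ℝ → ℝ} {F : ℝ × ℝ → ℝ} (hf : ∀ θ, ConcaveOn ℝ s (f θ))
    (hint : ∀ z ∈ s, Integrable (fun θ => f θ z) μ) (hF : ∀ z ∈ s, F z = ∫ θ, f θ z ∂μ)
    {a : ℝ} {z w : ℝ × ℝ} (ha : a ∈ Icc (0 : ℝ) 1) (hz : z ∈ s) (hw : w ∈ s)
    (h : JensenEq F a z w) : ∀ᵐ θ ∂μ, JensenEq (f θ) a z w := by
  have hnn : ∀ θ, 0 ≤ f θ (a • z + (1 - a) • w) - (a * f θ z + (1 - a) * f θ w) := fun θ => by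
    have := (hf θ).2 hz hw ha.1 (sub_nonneg.2 ha.2) (by ring)
    simpa using this
  rcases isEmpty_or_nonempty T with hT | ⟨⟨θ₀⟩⟩
  · exact Filter.Eventually.of_forall fun θ => hT.elim θ
  have hm : a • z + (1 - a) • w ∈ s :=
    (hf θ₀).1 hz hw ha.1 (sub_nonneg.2 ha.2) (by ring)
  have hi : Integrable (fun θ => a * f θ z + (1 - a) * f θ w) μ :=
    ((hint z hz).const_mul a).add ((hint w hw).const_mul (1 - a))
  have h0 : ∫ θ, (f θ (a • z + (1 - a) • w) - (a * f θ z + (1 - a) * f θ w)) ∂μ = 0 := by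
    rw [integral_sub (hint _ hm) hi,
      integral_add ((hint z hz).const_mul a) ((hint w hw).const_mul (1 - a)),
      integral_const_mul, integral_const_mul, ← hF _ hm, ← hF _ hz, ← hF _ hw, sub_eq_zero]
    exact h
  rw [integral_eq_zero_iff_of_nonneg hnn ((hint _ hm).sub hi)] at h0
  filter_upwards [h0] with θ hθ
  exact sub_eq_zero.1 hθ

/-! ### A planar triangle inside the simplex -/

/-- The triangle of pairs `(x, y)` with `x, y ≥ 0` and `x + y ≤ 1`. -/
def triangle : Set (ℝ × ℝ) := {z | 0 ≤ z.1 ∧ 0 ≤ z.2 ∧ z.1 + z.2 ≤ 1}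

lemma convex_triangle : Convex ℝ triangle := by
  rintro z ⟨h1, h2, h3⟩ w ⟨k1, k2, k3⟩ a b ha hb hab
  refine ⟨?_, ?_, ?_⟩
  · simp only [Prod.fst_add, Prod.smul_fst, smul_eq_mul]; positivity
  · simp only [Prod.snd_add, Prod.smul_snd, smul_eq_mul]; positivity
  · simp only [Prod.fst_add, Prod.smul_fst, Prod.snd_add, Prod.smul_snd, smul_eq_mul]
    nlinarith

/-- The vector with coordinates `x`, `y`, `1 - x - y` at `i`, `j`, `k`, and zero elsewhere. -/
def triangleVec {K : ℕ} (i j k : Fin K) (z : ℝ × ℝ) : Fin K → ℝ :=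
  Pi.single i z.1 + Pi.single j z.2 + Pi.single k (1 - z.1 - z.2)

lemma triangleVec_mem {K : ℕ} (i j k : Fin K) {z : ℝ × ℝ} (hz : z ∈ triangle) :
    triangleVec i j k z ∈ stdSimplex ℝ (Fin K) := by
  obtain ⟨h1, h2, h3⟩ := hz
  refine ⟨fun x => ?_, ?_⟩
  · have e : ∀ (l : Fin K) {c : ℝ}, 0 ≤ c → 0 ≤ (Pi.single l c : Fin K → ℝ) x := fun l c hc => by
      rw [Pi.single_apply]; split_ifs <;> simp [hc]
    exact add_nonneg (add_nonneg (e i h1) (e j h2)) (e k (by linarith))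
  · simp [triangleVec, Finset.sum_add_distrib]

open Classical in
/-- The embedding of the triangle as the face of the simplex spanned by the vertices `i`, `j`, `k`,
extended to the plane by an arbitrary value. -/
noncomputable def trianglePoint {K : ℕ} (i j k : Fin K) (z : ℝ × ℝ) : stdSimplex ℝ (Fin K) :=
  if h : z ∈ triangle then ⟨triangleVec i j k z, triangleVec_mem i j k h⟩
  else ⟨Pi.single i 1, single_mem_stdSimplex ℝ i⟩

lemma coe_trianglePoint {K : ℕ} (i j k : Fin K) {z : ℝ × ℝ} (hz : z ∈ triangle) :
    (trianglePoint i j k z : Fin K → ℝ) = triangleVec i j k z := by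
  rw [trianglePoint, dif_pos hz]
  rfl

/-- The univariate form of a proper scoring rule is concave, being a minimum of the linear
functions `q ↦ ℓ(p; q)`. -/
lemma concaveOn_univariate_trianglePoint {K : ℕ} {ℓ : ScoringRule K} (hℓ : IsProper ℓ)
    (i j k : Fin K) : ConcaveOn ℝ triangle fun z => univariate ℓ (trianglePoint i j k z) := by
  refine ⟨convex_triangle, fun z hz w hw a b ha hb hab => ?_⟩
  have hm := convex_triangle hz hw ha hb hab
  set c := trianglePoint i j k (a • z + b • w) with hc
  have hcomb : expectedPenalty ℓ c c = a * expectedPenalty ℓ c (trianglePoint i j k z)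
      + b * expectedPenalty ℓ c (trianglePoint i j k w) := by
    have hvec : (c : Fin K → ℝ) = fun x => a * (trianglePoint i j k z : Fin K → ℝ) x
        + b * (trianglePoint i j k w : Fin K → ℝ) x := by
      rw [hc, coe_trianglePoint _ _ _ hm, coe_trianglePoint _ _ _ hz, coe_trianglePoint _ _ _ hw]
      obtain rfl : b = 1 - a := by linarith
      ext x
      simp only [triangleVec, Pi.add_apply, Pi.single_apply, Prod.fst_add, Prod.smul_fst,
        Prod.snd_add, Prod.smul_snd, smul_eq_mul]
      split_ifs <;> ring
    unfold expectedPenalty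
    rw [Finset.mul_sum, Finset.mul_sum, ← Finset.sum_add_distrib]
    refine Finset.sum_congr rfl fun x _ => ?_
    rw [congrFun hvec x]
    ring
  change a * expectedPenalty ℓ _ _ + b * expectedPenalty ℓ _ _ ≤ expectedPenalty ℓ c c
  rw [hcomb]
  exact add_le_add (mul_le_mul_of_nonneg_left (hℓ _ _) ha) (mul_le_mul_of_nonneg_left (hℓ _ _) hb)

/-! ### The convex profiles and their scoring rules -/

/-- The spacing of the columns `x = j * mesh n`, `j ≤ n + 1`, which fill `[0, 1 / 2]`. -/
noncomputable def mesh (n : ℕ) : ℝ := 1 / (2 * (n + 1))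

lemma mesh_pos (n : ℕ) : 0 < mesh n := by unfold mesh; positivity

lemma mul_mesh_le {n j : ℕ} (hj : j ≤ n + 1) : j * mesh n ≤ 1 / 2 := by
  have hj' : (j : ℝ) ≤ n + 1 := by exact_mod_cast hj
  unfold mesh
  rw [mul_one_div, div_le_div_iff₀ (by positivity) (by norm_num)]
  linarith

/-- The convex piecewise linear function with slope `0` near `0` whose slope jumps by `w k` at the
`k + 1`-st column. -/
noncomputable def profile {n : ℕ} (w : Fin n → ℝ) (x : ℝ) : ℝ :=
  1 / 8 + ∑ k, w k * max 0 (x - (k + 1) * mesh n)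

/-- The admissible jumps. The bound keeps the profile between `1 / 8` and `1 / 4` on `[0, 1 / 2]`
and the scoring rule within `[-1, 1]`. -/
def weights (n : ℕ) : Set (Fin n → ℝ) := univ.pi fun _ => Ioo 0 (1 / (8 * (n + 1)))

lemma sum_weights_le {n : ℕ} {w : Fin n → ℝ} (hw : w ∈ weights n) : ∑ k, w k ≤ 1 / 8 := by
  calc ∑ k, w k ≤ ∑ _k : Fin n, (1 / (8 * (n + 1)) : ℝ) :=
        Finset.sum_le_sum fun k _ => (hw k (mem_univ k)).2.le
    _ = n * (1 / (8 * (n + 1))) := by simp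
    _ ≤ 1 / 8 := by
        rw [mul_one_div, div_le_div_iff₀ (by positivity) (by norm_num)]
        linarith

lemma le_profile {n : ℕ} {w : Fin n → ℝ} (hw : w ∈ weights n) (x : ℝ) : 1 / 8 ≤ profile w x :=
  le_add_of_nonneg_right <| Finset.sum_nonneg fun k _ =>
    mul_nonneg (hw k (mem_univ k)).1.le (le_max_left _ _)

lemma profile_le {n : ℕ} {w : Fin n → ℝ} (hw : w ∈ weights n) {x : ℝ} (hx : x ≤ 1 / 2) :
    profile w x ≤ 1 / 4 := by
  have h : ∑ k, w k * max 0 (x - (k + 1) * mesh n) ≤ ∑ k, w k := by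
    refine Finset.sum_le_sum fun k _ => mul_le_of_le_one_right (hw k (mem_univ k)).1.le ?_
    have : 0 ≤ ((k : ℝ) + 1) * mesh n := mul_nonneg (by positivity) (mesh_pos n).le
    exact max_le zero_le_one (by linarith)
  have := sum_weights_le hw
  unfold profile
  linarith

/-- The profile is affine between neighbouring columns. -/
lemma profile_midpoint {n : ℕ} (w : Fin n → ℝ) (j : ℕ) :
    profile w ((j + 1 / 2) * mesh n)
      = (profile w (j * mesh n) + profile w ((j + 1) * mesh n)) / 2 := by
  have h : ∀ k : Fin n, w k * max 0 ((j + 1 / 2) * mesh n - (k + 1) * mesh n)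
      = (w k * max 0 (j * mesh n - (k + 1) * mesh n)
        + w k * max 0 ((j + 1) * mesh n - (k + 1) * mesh n)) / 2 := fun k => by
    have hm := mesh_pos n
    rcases le_or_gt (k.val + 1) j with hk | hk
    · have hk' : (k : ℝ) + 1 ≤ j := by exact_mod_cast hk
      rw [max_eq_right (by nlinarith), max_eq_right (by nlinarith), max_eq_right (by nlinarith)]
      ring
    · have hk' : (j : ℝ) + 1 ≤ k + 1 := by exact_mod_cast hk
      rw [max_eq_left (by nlinarith), max_eq_left (by nlinarith), max_eq_left (by nlinarith)]
      ring
  unfold profile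
  rw [Finset.sum_congr rfl fun k _ => h k, ← Finset.sum_div, Finset.sum_add_distrib]
  ring

/-- The second differences of the profile along the columns read off the jumps. -/
lemma profile_second_difference {n : ℕ} (w : Fin n → ℝ) (k : Fin n) :
    profile w ((k + 2 : ℕ) * mesh n) - 2 * profile w ((k + 1 : ℕ) * mesh n)
      + profile w ((k : ℕ) * mesh n) = w k * mesh n := by
  have hm := mesh_pos n
  have h : ∀ l : Fin n, w l * max 0 ((k + 2 : ℕ) * mesh n - (l + 1) * mesh n)
      - 2 * (w l * max 0 ((k + 1 : ℕ) * mesh n - (l + 1) * mesh n))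
      + w l * max 0 ((k : ℕ) * mesh n - (l + 1) * mesh n)
      = if l = k then w k * mesh n else 0 := fun l => by
    push_cast
    split_ifs with hlk
    · subst hlk
      rw [max_eq_right (by nlinarith), max_eq_right (by nlinarith), max_eq_left (by nlinarith)]
      ring
    · rcases lt_or_gt_of_ne (fun e => hlk (Fin.ext e)) with hk | hk
      · have hk' : (l : ℝ) + 1 ≤ k := by exact_mod_cast hk
        rw [max_eq_right (by nlinarith), max_eq_right (by nlinarith), max_eq_right (by nlinarith)]
        ring
      · have hk' : (k : ℝ) + 1 ≤ l := by exact_mod_cast hk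
        rw [max_eq_left (by nlinarith), max_eq_left (by nlinarith), max_eq_left (by nlinarith)]
        ring
  have hs : ∑ l, (w l * max 0 ((k + 2 : ℕ) * mesh n - (l + 1) * mesh n)
      - 2 * (w l * max 0 ((k + 1 : ℕ) * mesh n - (l + 1) * mesh n))
      + w l * max 0 ((k : ℕ) * mesh n - (l + 1) * mesh n)) = w k * mesh n := by
    rw [Finset.sum_congr rfl fun l _ => h l]
    simp
  rw [Finset.sum_add_distrib, Finset.sum_sub_distrib, ← Finset.mul_sum] at hs
  unfold profile
  linarith

/-- The concave function vanishing above the graph of the profile and of slope one in `y` below. -/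
noncomputable def kinked {n : ℕ} (w : Fin n → ℝ) (z : ℝ × ℝ) : ℝ := min 0 (z.2 - profile w z.1)

lemma kinked_of_le {n : ℕ} {w : Fin n → ℝ} {x y : ℝ} (h : y ≤ profile w x) :
    kinked w (x, y) = y - profile w x := min_eq_right (by simpa using h)

lemma kinked_of_ge {n : ℕ} {w : Fin n → ℝ} {x y : ℝ} (h : profile w x ≤ y) :
    kinked w (x, y) = 0 := min_eq_left (by simpa using h)

/-- The scoring rule with univariate form `min 0 (p j - profile w (p i))`: at `p` it charges, for
the outcome `x`, the value at the vertex `x` of a supporting linear function at `p`. -/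
noncomputable def kinkedRule {n K : ℕ} (w : Fin n → ℝ) (i j : Fin K) : ScoringRule K := fun p x =>
  if profile w ((p : Fin K → ℝ) i) ≤ (p : Fin K → ℝ) j then 0
  else (Pi.single j 1 : Fin K → ℝ) x - 1 / 8
    - ∑ k : Fin n, if ((k : ℝ) + 1) * mesh n < (p : Fin K → ℝ) i
        then w k * ((Pi.single i 1 : Fin K → ℝ) x - (k + 1) * mesh n) else 0

lemma expectedPenalty_kinkedRule {n K : ℕ} (w : Fin n → ℝ) (i j : Fin K)
    (p q : stdSimplex ℝ (Fin K)) :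
    expectedPenalty (kinkedRule w i j) p q =
      if profile w ((p : Fin K → ℝ) i) ≤ (p : Fin K → ℝ) j then 0
      else (q : Fin K → ℝ) j - 1 / 8
        - ∑ k : Fin n, if ((k : ℝ) + 1) * mesh n < (p : Fin K → ℝ) i
            then w k * ((q : Fin K → ℝ) i - (k + 1) * mesh n) else 0 := by
  have hq : ∑ x, (q : Fin K → ℝ) x = 1 := q.2.2
  have hsing : ∀ l : Fin K, ∑ x, (q : Fin K → ℝ) x * (Pi.single l 1 : Fin K → ℝ) x
      = (q : Fin K → ℝ) l := fun l => by simp [Pi.single_apply]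
  unfold expectedPenalty kinkedRule
  split_ifs with h
  · simp
  · simp only [mul_sub, Finset.sum_sub_distrib, ← Finset.sum_mul, hq, hsing, Finset.mul_sum,
      one_mul]
    rw [Finset.sum_comm]
    congr 1
    refine Finset.sum_congr rfl fun k _ => ?_
    split_ifs with hk
    · have : ∀ x, (q : Fin K → ℝ) x * (w k * (Pi.single i 1 : Fin K → ℝ) x
          - w k * ((k + 1) * mesh n))
          = w k * ((q : Fin K → ℝ) x * (Pi.single i 1 : Fin K → ℝ) x)
            - (q : Fin K → ℝ) x * (w k * ((k + 1) * mesh n)) := fun x => by ring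
      rw [Finset.sum_congr rfl fun x _ => this x, Finset.sum_sub_distrib, ← Finset.mul_sum, hsing,
        ← Finset.sum_mul, hq, one_mul]
    · simp

lemma univariate_kinkedRule {n K : ℕ} (w : Fin n → ℝ) (i j : Fin K)
    (p : stdSimplex ℝ (Fin K)) :
    univariate (kinkedRule w i j) p = kinked w ((p : Fin K → ℝ) i, (p : Fin K → ℝ) j) := by
  rw [univariate, expectedPenalty_kinkedRule]
  split_ifs with h
  · rw [kinked_of_ge h]
  · rw [kinked_of_le (not_le.1 h).le, profile, ← sub_sub]
    congr 1
    refine Finset.sum_congr rfl fun k _ => ?_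
    split_ifs with hk
    · rw [max_eq_right (by linarith)]
    · rw [max_eq_left (by linarith), mul_zero]

lemma kinkedRule_mem_boundedProper {n K : ℕ} {w : Fin n → ℝ} (hw : w ∈ weights n) (i j : Fin K) :
    kinkedRule w i j ∈ boundedProper K := by
  have hw0 : ∀ k, 0 ≤ w k := fun k => (hw k (mem_univ k)).1.le
  refine ⟨fun p p' => ?_, fun p x => ?_⟩
  · change univariate _ p ≤ _
    rw [univariate_kinkedRule, expectedPenalty_kinkedRule, kinked]
    split_ifs with h
    · exact min_le_left _ _
    · refine (min_le_right _ _).trans ?_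
      rw [profile, ← sub_sub]
      refine sub_le_sub_left (Finset.sum_le_sum fun k _ => ?_) _
      split_ifs with hk
      · exact mul_le_mul_of_nonneg_left (le_max_right _ _) (hw0 k)
      · exact mul_nonneg (hw0 k) (le_max_left _ _)
  · have hs : ∀ l : Fin K, (Pi.single l 1 : Fin K → ℝ) x ∈ Icc (0 : ℝ) 1 := fun l => by
      rw [Pi.single_apply]; split_ifs <;> simp
    have hsum : |∑ k : Fin n, if ((k : ℝ) + 1) * mesh n < (p : Fin K → ℝ) i
        then w k * ((Pi.single i 1 : Fin K → ℝ) x - (k + 1) * mesh n) else 0| ≤ 1 / 8 := by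
      refine ((Finset.abs_sum_le_sum_abs _ _).trans (Finset.sum_le_sum fun k _ => ?_)).trans
        (sum_weights_le hw)
      split_ifs with hk
      · have h1 : ((k : ℕ) + 1 : ℕ) * mesh n ≤ 1 / 2 := mul_mesh_le (by omega)
        push_cast at h1
        have h2 : 0 ≤ ((k : ℝ) + 1) * mesh n := mul_nonneg (by positivity) (mesh_pos n).le
        rw [abs_mul, abs_of_nonneg (hw0 k)]
        refine mul_le_of_le_one_right (hw0 k) (abs_le.2 ⟨?_, ?_⟩) <;>
          linarith [(hs i).1, (hs i).2]
      · simpa using hw0 k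
    have := abs_le.1 hsum
    unfold kinkedRule
    split_ifs
    · simp
    · constructor <;> linarith [(hs j).1, (hs j).2, this.1, this.2]

/-! ### Rigidity of the kinked functions -/

lemma column_combination_low (x : ℝ) {g : ℝ} (hg : g ≠ 0) :
    (1 / (8 * g)) • (x, g) + (1 - 1 / (8 * g)) • (x, (0 : ℝ)) = (x, 1 / 8) := by
  ext
  · simp only [Prod.fst_add, Prod.smul_fst, smul_eq_mul]; ring
  · simp only [Prod.snd_add, Prod.smul_snd, smul_eq_mul]; field_simp; ring

lemma column_combination_high (x : ℝ) {g : ℝ} (hg : 1 / 2 - g ≠ 0) :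
    ((1 / 4 - g) / (1 / 2 - g)) • (x, (1 / 2 : ℝ))
      + (1 - (1 / 4 - g) / (1 / 2 - g)) • (x, g) = (x, 1 / 4) := by
  ext
  · simp only [Prod.fst_add, Prod.smul_fst, smul_eq_mul]; ring
  · simp only [Prod.snd_add, Prod.smul_snd, smul_eq_mul]
    rw [one_sub_div hg, div_mul_eq_mul_div, div_mul_eq_mul_div, ← add_div, div_eq_iff hg]
    ring

/-- Jensen equalities along the columns and along the diagonals of the cells below and above the
graph of the profile. -/
def CellwiseAffine {n : ℕ} (w : Fin n → ℝ) (φ : ℝ × ℝ → ℝ) : Prop :=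
  (∀ j : ℕ, j ≤ n + 1 →
    JensenEq φ (1 / (8 * profile w (j * mesh n)))
        (j * mesh n, profile w (j * mesh n)) (j * mesh n, 0) ∧
    JensenEq φ ((1 / 4 - profile w (j * mesh n)) / (1 / 2 - profile w (j * mesh n)))
        (j * mesh n, 1 / 2) (j * mesh n, profile w (j * mesh n))) ∧
  ∀ j : ℕ, j ≤ n →
    JensenEq φ (1 / 2) (j * mesh n, 0) ((j + 1 : ℕ) * mesh n, 1 / 8) ∧
    JensenEq φ (1 / 2) (j * mesh n, 1 / 8) ((j + 1 : ℕ) * mesh n, 0) ∧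
    JensenEq φ (1 / 2) (j * mesh n, 1 / 4) ((j + 1 : ℕ) * mesh n, 1 / 2) ∧
    JensenEq φ (1 / 2) (j * mesh n, 1 / 2) ((j + 1 : ℕ) * mesh n, 1 / 4)

lemma cellwiseAffine_kinked {n : ℕ} {w : Fin n → ℝ} (hw : w ∈ weights n) :
    CellwiseAffine w (kinked w) := by
  refine ⟨fun j hj => ?_, fun j hj => ?_⟩
  · have hx := mul_mesh_le hj
    set x := (j : ℝ) * mesh n
    have h1 := le_profile hw x
    have h2 := profile_le hw hx
    constructor
    · have hg : profile w x ≠ 0 := by linarith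
      rw [JensenEq, column_combination_low x hg, kinked_of_le h1, kinked_of_le le_rfl,
        kinked_of_le (by linarith)]
      field_simp; ring
    · rw [JensenEq, column_combination_high x (by linarith), kinked_of_ge h2,
        kinked_of_ge le_rfl, kinked_of_ge (by linarith)]
      ring
  · have hm := mesh_pos n
    have hx := mul_mesh_le (show j + 1 ≤ n + 1 by omega)
    push_cast at hx
    have e : ∀ y y' : ℝ, ((1 / 2 : ℝ) • ((j : ℝ) * mesh n, y)
        + (1 - 1 / 2 : ℝ) • (((j : ℝ) + 1) * mesh n, y'))
        = (((j : ℝ) + 1 / 2) * mesh n, (y + y') / 2) := fun y y' => by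
      ext
      · simp only [Prod.fst_add, Prod.smul_fst, smul_eq_mul]; ring
      · simp only [Prod.snd_add, Prod.smul_snd, smul_eq_mul]; ring
    have a1 := le_profile hw ((j : ℝ) * mesh n)
    have a2 := le_profile hw (((j : ℝ) + 1 / 2) * mesh n)
    have a3 := le_profile hw (((j : ℝ) + 1) * mesh n)
    have b1 := profile_le hw (x := (j : ℝ) * mesh n) (by nlinarith)
    have b2 := profile_le hw (x := ((j : ℝ) + 1 / 2) * mesh n) (by nlinarith)
    have b3 := profile_le hw hx
    have hp := profile_midpoint w j
    push_cast
    refine ⟨?_, ?_, ?_, ?_⟩ <;> rw [JensenEq, e]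
    · rw [kinked_of_le (by linarith), kinked_of_le (by linarith), kinked_of_le (by linarith), hp]
      ring
    · rw [kinked_of_le (by linarith), kinked_of_le (by linarith), kinked_of_le (by linarith), hp]
      ring
    · rw [kinked_of_ge (by linarith), kinked_of_ge (by linarith), kinked_of_ge (by linarith)]
      ring
    · rw [kinked_of_ge (by linarith), kinked_of_ge (by linarith), kinked_of_ge (by linarith)]
      ring

/-- The jump of the vertical slope across the profile, measured on the column `x = 0`. -/
noncomputable def slopeJump (φ : ℝ × ℝ → ℝ) : ℝ :=
  8 * (φ (0, 1 / 8) - φ (0, 0)) - 4 * (φ (0, 1 / 2) - φ (0, 1 / 4))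

lemma slopeJump_kinked {n : ℕ} {w : Fin n → ℝ} (hw : w ∈ weights n) :
    slopeJump (kinked w) = 1 := by
  have h1 := le_profile hw 0
  have h2 := profile_le hw (x := 0) (by norm_num)
  rw [slopeJump, kinked_of_le h1, kinked_of_le (by linarith), kinked_of_ge h2,
    kinked_of_ge (by linarith)]
  ring

/-- The parallelogram identity on a cell: if both diagonals have Jensen equality at their common
midpoint, the vertical increments on the two sides agree. -/
lemma vertical_increment_eq {φ : ℝ × ℝ → ℝ} {x x' y y' : ℝ}
    (h : JensenEq φ (1 / 2) (x, y) (x', y')) (h' : JensenEq φ (1 / 2) (x, y') (x', y)) :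
    φ (x', y') - φ (x', y) = φ (x, y') - φ (x, y) := by
  have e : ((1 / 2 : ℝ) • (x, y) + (1 - 1 / 2 : ℝ) • (x', y'))
      = (1 / 2 : ℝ) • (x, y') + (1 - 1 / 2 : ℝ) • (x', y) := by
    ext
    · simp
    · simp only [Prod.snd_add, Prod.smul_snd, smul_eq_mul]; ring
  rw [JensenEq, e, h'] at h
  linarith

/-- For a cellwise affine function the two vertical slopes are the same on all columns and change on
the graph of the profile, so the increment from height `0` to height `1 / 4` is `slopeJump φ` times
the profile plus a constant. Its second differences are therefore multiples of the jumps. -/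
lemma CellwiseAffine.second_difference {n : ℕ} {w : Fin n → ℝ} (hw : w ∈ weights n)
    {φ : ℝ × ℝ → ℝ} (h : CellwiseAffine w φ) (k : Fin n) :
    (φ ((k + 2 : ℕ) * mesh n, 1 / 4) - φ ((k + 2 : ℕ) * mesh n, 0))
      - 2 * (φ ((k + 1 : ℕ) * mesh n, 1 / 4) - φ ((k + 1 : ℕ) * mesh n, 0))
      + (φ ((k : ℕ) * mesh n, 1 / 4) - φ ((k : ℕ) * mesh n, 0))
      = slopeJump φ * (w k * mesh n) := by
  have hlow : ∀ j : ℕ, j ≤ n + 1 →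
      φ (j * mesh n, 1 / 8) - φ (j * mesh n, 0) = φ (0, 1 / 8) - φ (0, 0) := by
    intro j
    induction j with
    | zero => simp
    | succ j ih =>
      intro hj
      have hc := h.2 j (by omega)
      exact (vertical_increment_eq hc.1 hc.2.1).trans (ih (by omega))
  have hhigh : ∀ j : ℕ, j ≤ n + 1 →
      φ (j * mesh n, 1 / 2) - φ (j * mesh n, 1 / 4) = φ (0, 1 / 2) - φ (0, 1 / 4) := by
    intro j
    induction j with
    | zero => simp
    | succ j ih =>
      intro hj
      have hc := h.2 j (by omega)
      exact (vertical_increment_eq hc.2.2.1 hc.2.2.2).trans (ih (by omega))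
  -- Both slopes are known on every column and the two branches meet on the graph of the profile.
  have hcol : ∀ j : ℕ, j ≤ n + 1 → φ (j * mesh n, 1 / 4) - φ (j * mesh n, 0)
      = slopeJump φ * profile w (j * mesh n) + (φ (0, 1 / 2) - φ (0, 1 / 4)) := by
    intro j hj
    obtain ⟨hl, hh⟩ := h.1 j hj
    have hlj := hlow j hj
    have hhj := hhigh j hj
    have h1 := le_profile hw (j * mesh n)
    have h2 := profile_le hw (mul_mesh_le hj)
    set x := (j : ℝ) * mesh n
    set g := profile w x
    have hg : g ≠ 0 := by linarith
    have hg' : 1 / 2 - g ≠ 0 := by linarith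
    rw [JensenEq, column_combination_low x hg] at hl
    rw [JensenEq, column_combination_high x hg', one_sub_div hg'] at hh
    have hl' : 8 * g * (φ (x, 1 / 8) - φ (x, 0)) = φ (x, g) - φ (x, 0) := by
      rw [hl]; field_simp; ring
    have hh' : (1 / 2 - g) * φ (x, 1 / 4)
        = (1 / 4 - g) * φ (x, 1 / 2) + 1 / 4 * φ (x, g) := by
      rw [hh, mul_add, ← mul_assoc, ← mul_assoc, mul_div_cancel₀ _ hg', mul_div_cancel₀ _ hg']
      ring
    have hA : φ (x, 1 / 8) - φ (x, 0) = φ (0, 1 / 8) - φ (0, 0) := hlj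
    have hB : φ (x, 1 / 2) = φ (x, 1 / 4) + (φ (0, 1 / 2) - φ (0, 1 / 4)) := by linarith
    rw [hA] at hl'
    rw [hB] at hh'
    unfold slopeJump
    linarith
  have hk := k.2
  rw [hcol _ (by omega), hcol _ (by omega), hcol _ (by omega), ← profile_second_difference w k]
  ring

/-! ### Piecewise locally Lipschitz maps and Hausdorff dimension -/

/-- Finitely many piecewise locally Lipschitz real functions form a map which does not raise the
Hausdorff dimension. -/
lemma dimH_image_le_of_piecewiseLocallyLipschitz {X ι : Type*} [EMetricSpace X]
    [SecondCountableTopology X] [Fintype ι] {f : X → ι → ℝ}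
    (hf : ∀ i, PiecewiseLocallyLipschitz fun x => f x i) (s : Set X) :
    dimH (f '' s) ≤ dimH s := by
  choose S hS hL using hf
  have hcover : s = ⋃ m : ι → ℕ, s ∩ ⋂ i, S i (m i) := by
    refine Subset.antisymm (fun x hx => ?_) (iUnion_subset fun m => inter_subset_left)
    have : ∀ i, ∃ m, x ∈ S i m := fun i => mem_iUnion.1 (hS i ▸ mem_univ x)
    choose m hm using this
    exact mem_iUnion.2 ⟨m, hx, mem_iInter.2 hm⟩
  conv_lhs => rw [hcover]
  rw [image_iUnion, dimH_iUnion]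
  refine iSup_le fun m => le_trans ?_ (dimH_mono (inter_subset_left (t := ⋂ i, S i (m i))))
  refine dimH_image_le_of_locally_lipschitzOn fun x hx => ?_
  have hx' : ∀ i, x ∈ S i (m i) := mem_iInter.1 hx.2
  choose C t ht hC using fun i => hL i (m i) (hx' i)
  refine ⟨Finset.univ.sup C, ⋂ i, t i, Filter.iInter_mem.2 fun i =>
    nhdsWithin_mono x (inter_subset_right.trans (iInter_subset _ i)) (ht i), ?_⟩
  intro y hy z hz
  refine edist_pi_le_iff.2 fun i => (hC i (mem_iInter.1 hy i) (mem_iInter.1 hz i)).trans ?_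
  gcongr
  exact Finset.le_sup (Finset.mem_univ i)

lemma dimH_univ_subtype_le {N : ℕ} (Θ : Set (EuclideanSpace ℝ (Fin N))) :
    dimH (univ : Set Θ) ≤ N := by
  rw [← (isometry_subtype_coe (s := Θ)).dimH_image]
  refine (dimH_mono (subset_univ _)).trans ?_
  rw [Real.dimH_univ_eq_finrank]
  simp

lemma dimH_weights (n : ℕ) : dimH (weights n) = n := by
  have hne : (interior (weights n)).Nonempty := by
    rw [(isOpen_set_pi finite_univ fun _ _ => isOpen_Ioo).interior_eq (s := weights n)]
    refine univ_pi_nonempty_iff.2 fun _ => nonempty_Ioo.2 (by positivity)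
  rw [Real.dimH_of_nonempty_interior hne]
  simp

/-! ### Recovering the profile from an element of the family -/

/-- The heights at which functions on the triangle are sampled on each column. -/
noncomputable def sampleHeight : Fin 4 → ℝ := ![0, 1 / 8, 1 / 4, 1 / 2]

/-- The values of a function on the triangle at the sample points. -/
noncomputable def samples (n : ℕ) (φ : ℝ × ℝ → ℝ) : Fin (n + 2) × Fin 4 → ℝ := fun q =>
  φ ((q.1 : ℕ) * mesh n, sampleHeight q.2)

/-- `slopeJump` in terms of the samples. -/
def sampledJump {n : ℕ} (v : Fin (n + 2) × Fin 4 → ℝ) : ℝ :=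
  8 * (v (0, 1) - v (0, 0)) - 4 * (v (0, 3) - v (0, 2))

/-- The jumps of the profile in terms of the samples of a cellwise affine function. -/
noncomputable def recover {n : ℕ} (v : Fin (n + 2) × Fin 4 → ℝ) (k : Fin n) : ℝ :=
  ((v (k.succ.succ, 2) - v (k.succ.succ, 0)) - 2 * (v (k.succ.castSucc, 2) - v (k.succ.castSucc, 0))
    + (v (k.castSucc.castSucc, 2) - v (k.castSucc.castSucc, 0))) / (sampledJump v * mesh n)

lemma sampledJump_samples (n : ℕ) (φ : ℝ × ℝ → ℝ) : sampledJump (samples n φ) = slopeJump φ := by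
  simp [sampledJump, samples, sampleHeight, slopeJump]

lemma CellwiseAffine.recover_samples {n : ℕ} {w : Fin n → ℝ} (hw : w ∈ weights n)
    {φ : ℝ × ℝ → ℝ} (h : CellwiseAffine w φ) (hφ : 0 < slopeJump φ) :
    recover (samples n φ) = w := by
  ext k
  rw [recover, sampledJump_samples, div_eq_iff (mul_pos hφ (mesh_pos n)).ne']
  have := h.second_difference hw k
  simp only [samples, sampleHeight, Fin.val_succ, Fin.val_castSucc, Matrix.cons_val,
    Matrix.cons_val_zero]
  rw [show (k : ℕ) + 1 + 1 = k + 2 from rfl, this]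
  ring

lemma dimH_image_recover_le {n : ℕ} {t : Set (Fin (n + 2) × Fin 4 → ℝ)}
    (ht : ∀ v ∈ t, 0 < sampledJump v) : dimH (recover '' t) ≤ dimH t := by
  -- On this half-space the denominator does not vanish, and convexity makes `C¹` maps locally
  -- Lipschitz.
  have hconv : Convex ℝ {v : Fin (n + 2) × Fin 4 → ℝ | 0 < sampledJump v} := by
    intro v hv v' hv' a b ha hb hab
    have e : sampledJump (a • v + b • v') = a * sampledJump v + b * sampledJump v' := by
      simp only [sampledJump, Pi.add_apply, Pi.smul_apply, smul_eq_mul]; ring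
    change 0 < sampledJump (a • v + b • v')
    rw [e]
    rcases ha.eq_or_lt with rfl | ha
    · obtain rfl : b = 1 := by linarith
      simpa using hv'
    · exact add_pos_of_pos_of_nonneg (mul_pos ha hv) (mul_nonneg hb (le_of_lt hv'))
  refine ContDiffOn.dimH_image_le (contDiffOn_pi.2 fun k => ?_) hconv ht
  unfold recover
  refine ContDiffOn.div ?_ ?_ fun v hv => (mul_pos hv (mesh_pos n)).ne'
  · fun_prop
  · unfold sampledJump
    fun_prop

/-- Some member of a family representing a kinked scoring rule is, up to an affine function, a
positive multiple of it on all cells: cell by cell almost all are affine, and the slope jumps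
average to one. -/
lemma exists_cellwiseAffine_of_integral {T : Type*} [MeasurableSpace T] {μ : Measure T}
    {f : T → ℝ × ℝ → ℝ} {n : ℕ} {w : Fin n → ℝ} (hw : w ∈ weights n)
    (hf : ∀ θ, ConcaveOn ℝ triangle (f θ))
    (hint : ∀ z ∈ triangle, Integrable (fun θ => f θ z) μ)
    (hF : ∀ z ∈ triangle, kinked w z = ∫ θ, f θ z ∂μ) :
    ∃ θ, CellwiseAffine w (f θ) ∧ 0 < slopeJump (f θ) := by
  have hmem : ∀ {j : ℕ} {y : ℝ}, j ≤ n + 1 → 0 ≤ y → y ≤ 1 / 2 →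
      ((j : ℝ) * mesh n, y) ∈ triangle := fun hj h0 h1 => by
    have := mul_mesh_le hj
    exact ⟨mul_nonneg (Nat.cast_nonneg _) (mesh_pos n).le, h0, by dsimp only; linarith⟩
  have hae : ∀ᵐ θ ∂μ, CellwiseAffine w (f θ) := by
    obtain ⟨hcol, hcell⟩ := cellwiseAffine_kinked hw
    refine Filter.Eventually.and ?_ ?_
    · refine ae_all_iff.2 fun j => Filter.eventually_imp_distrib_left.2 fun hj => ?_
      have h1 := le_profile hw (j * mesh n)
      have h2 := profile_le hw (mul_mesh_le hj)
      refine (ae_jensenEq_of_integral hf hint hF ⟨by positivity, ?_⟩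
          (hmem hj (by linarith) (by linarith)) (hmem hj le_rfl (by norm_num)) (hcol j hj).1).and
        (ae_jensenEq_of_integral hf hint hF ⟨?_, ?_⟩ (hmem hj (by norm_num) le_rfl)
          (hmem hj (by linarith) (by linarith)) (hcol j hj).2)
      · rw [div_le_one (by linarith)]; linarith
      · exact div_nonneg (by linarith) (by linarith)
      · rw [div_le_one (by linarith)]; linarith
    · refine ae_all_iff.2 fun j => Filter.eventually_imp_distrib_left.2 fun hj => ?_
      have hj0 : j ≤ n + 1 := by omega
      have hj1 : j + 1 ≤ n + 1 := by omega
      have key : ∀ {y y' : ℝ}, 0 ≤ y → y ≤ 1 / 2 → 0 ≤ y' → y' ≤ 1 / 2 →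
          JensenEq (kinked w) (1 / 2) (j * mesh n, y) ((j + 1 : ℕ) * mesh n, y') →
          ∀ᵐ θ ∂μ, JensenEq (f θ) (1 / 2) (j * mesh n, y) ((j + 1 : ℕ) * mesh n, y') :=
        fun a1 a2 b1 b2 => ae_jensenEq_of_integral hf hint hF ⟨by norm_num, by norm_num⟩
          (hmem hj0 a1 a2) (hmem hj1 b1 b2)
      obtain ⟨c1, c2, c3, c4⟩ := hcell j hj
      exact (key (by norm_num) (by norm_num) (by norm_num) (by norm_num) c1).and
        ((key (by norm_num) (by norm_num) (by norm_num) (by norm_num) c2).and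
        ((key (by norm_num) (by norm_num) (by norm_num) (by norm_num) c3).and
        (key (by norm_num) (by norm_num) (by norm_num) (by norm_num) c4)))
  have hz : ∀ {y : ℝ}, 0 ≤ y → y ≤ 1 / 2 → ((0 : ℝ), y) ∈ triangle := fun h0 h1 =>
    ⟨le_rfl, h0, by dsimp only; linarith⟩
  have z0 := hz (y := 0) le_rfl (by norm_num)
  have z1 := hz (y := 1 / 8) (by norm_num) (by norm_num)
  have z2 := hz (y := 1 / 4) (by norm_num) (by norm_num)
  have z3 := hz (y := 1 / 2) (by norm_num) (by norm_num)
  have hjump : ∫ θ, slopeJump (f θ) ∂μ = 1 := by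
    rw [← slopeJump_kinked hw]
    unfold slopeJump
    have i1 : Integrable (fun θ => f θ (0, 1 / 8) - f θ (0, 0)) μ := (hint _ z1).sub (hint _ z0)
    have i2 : Integrable (fun θ => f θ (0, 1 / 2) - f θ (0, 1 / 4)) μ := (hint _ z3).sub (hint _ z2)
    rw [integral_sub (i1.const_mul 8) (i2.const_mul 4), integral_const_mul, integral_const_mul,
      integral_sub (hint _ z1) (hint _ z0), integral_sub (hint _ z3) (hint _ z2),
      hF _ z0, hF _ z1, hF _ z2, hF _ z3]
  by_contra! hno
  have : ∫ θ, slopeJump (f θ) ∂μ ≤ 0 :=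
    integral_nonpos_of_ae (hae.mono fun θ hθ => hno θ hθ)
  linarith

end UCal

theorem mainTheorem9 (K : ℕ) (hK : 4 ≤ K) (N : ℕ) (Θ : Set (EuclideanSpace ℝ (Fin N)))
    (ℓ : Θ → UCal.ScoringRule K) (hℓ : ∀ θ, ℓ θ ∈ UCal.boundedProper K)
    (grad : Θ → stdSimplex ℝ (Fin K) → (Fin K → ℝ))
    (hgrad : ∀ θ p, UCal.IsSubgradientAt (UCal.univariate (ℓ θ)) p (grad θ p))
    (hval_lip : ∀ p, UCal.PiecewiseLocallyLipschitz (fun θ => UCal.univariate (ℓ θ) p))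
    (hgrad_lip : ∀ p, UCal.PiecewiseLocallyLipschitz (fun θ => grad θ p)) :
    ∃ ℓ₀ ∈ UCal.boundedProper K,
      ∀ μ : Measure Θ, IsFiniteMeasure μ → ¬ UCal.IsMixture ℓ₀ ℓ μ := by
  classical
  let i : Fin K := ⟨0, by omega⟩
  let j : Fin K := ⟨1, by omega⟩
  let k : Fin K := ⟨2, by omega⟩
  have hij : i ≠ j := by simp [i, j]
  have hik : i ≠ k := by simp [i, k]
  have hjk : j ≠ k := by simp [j, k]
  let f : Θ → ℝ × ℝ → ℝ := fun θ z => UCal.univariate (ℓ θ) (UCal.trianglePoint i j k z)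
  by_contra! hall
  -- One kink more than the dimension of the parameter space.
  have hex : ∀ w ∈ UCal.weights (N + 1),
      ∃ θ, UCal.CellwiseAffine w (f θ) ∧ 0 < UCal.slopeJump (f θ) := by
    intro w hw
    obtain ⟨μ, -, hμ⟩ := hall _ (UCal.kinkedRule_mem_boundedProper hw i j)
    refine UCal.exists_cellwiseAffine_of_integral (μ := μ) hw
      (fun θ => UCal.concaveOn_univariate_trianglePoint (hℓ θ).1 i j k) (fun z _ => (hμ _).1)
      fun z hz => ?_
    rw [← (hμ _).2, UCal.univariate_kinkedRule, UCal.coe_trianglePoint _ _ _ hz]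
    congr 1
    ext <;> simp [UCal.triangleVec, hij, hik, hjk, hij.symm]
  let F : Θ → Fin (N + 1 + 2) × Fin 4 → ℝ := fun θ => UCal.samples (N + 1) (f θ)
  let s : Set Θ := {θ | 0 < UCal.slopeJump (f θ)}
  have hsub : UCal.weights (N + 1) ⊆ UCal.recover '' (F '' s) := by
    intro w hw
    obtain ⟨θ, hθ, hpos⟩ := hex w hw
    exact ⟨F θ, ⟨θ, hpos, rfl⟩, hθ.recover_samples hw hpos⟩
  have hdim : ((N + 1 : ℕ) : ENNReal) ≤ N := calc
    ((N + 1 : ℕ) : ENNReal) = dimH (UCal.weights (N + 1)) := (UCal.dimH_weights _).symm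
    _ ≤ dimH (UCal.recover '' (F '' s)) := dimH_mono hsub
    _ ≤ dimH (F '' s) := UCal.dimH_image_recover_le (by
        rintro _ ⟨θ, hθ, rfl⟩
        rw [UCal.sampledJump_samples]
        exact hθ)
    _ ≤ dimH s := UCal.dimH_image_le_of_piecewiseLocallyLipschitz (fun q => hval_lip _) s
    _ ≤ dimH (Set.univ : Set Θ) := dimH_mono (Set.subset_univ _)
    _ ≤ N := UCal.dimH_univ_subtype_le Θ
  exact absurd (Nat.cast_le.1 hdim) (by omega)
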